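/- Let $G$ be a group, let $G^{\varphi}$ be an isomorphic copy of $G$ via $g\mapsto g^{\varphi}$, and let \[ \chi(G)=\langle\, G\cup G^{\varphi} \mid [g,g^{\varphi}]=1 \text{ for all } g\in G\,\rangle \] be the weak commutativity group of $G$, that is, the quotient of the free product $G * G^{\varphi}$ by the normal closure of the elements $[g,g^{\varphi}]$, $g\in G$. In $\chi(G)$ put $L(G)=\langle g^{-1}g^{\varphi}\mid g\in G\rangle$, $L_1(G)=[L(G),G]$, $L_2(G)=[L(G),G^{\varphi}]$ and $L_{1,2}(G)=[L_1(G),L_2(G)]$, where $[H,K]$ denotes the subgroup generated by all commutators $[h,k]$ with $h\in H$ and $k\in K$. If $G$ is finitely generated and periodic (every element of $G$ has finite order), then $L_{1,2}(G)$ is finite. -/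

import Mathlib

/-- The defining relators `[g, g^φ] = g⁻¹ (g^φ)⁻¹ g g^φ`, `g ∈ G`, of the weak commutativity group, inside the free
product of `G` (left factor) with its isomorphic copy `G^φ` (right factor). -/
def weakCommRelators (G : Type*) [Group G] : Set (Monoid.Coprod G G) :=
  Set.range fun g : G =>
    (Monoid.Coprod.inl g)⁻¹ * (Monoid.Coprod.inr g)⁻¹ * Monoid.Coprod.inl g * Monoid.Coprod.inr g

/-- Sidki's weak commutativity group
`χ(G) = ⟨G ∪ G^φ | [g, g^φ] = 1 for all g ∈ G⟩`. -/
abbrev WeakCommGroup (G : Type*) [Group G] : Type _ :=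
  Monoid.Coprod G G ⧸ Subgroup.normalClosure (weakCommRelators G)

namespace WeakCommGroup

/-- The canonical homomorphism `G → χ(G)`, `g ↦ g`. -/
def ofLeft (G : Type*) [Group G] : G →* WeakCommGroup G :=
  (QuotientGroup.mk' (Subgroup.normalClosure (weakCommRelators G))).comp Monoid.Coprod.inl

/-- The canonical homomorphism `G → χ(G)`, `g ↦ g^φ`. -/
def ofRight (G : Type*) [Group G] : G →* WeakCommGroup G :=
  (QuotientGroup.mk' (Subgroup.normalClosure (weakCommRelators G))).comp Monoid.Coprod.inr

/-- The subgroup `L(G) = ⟨g⁻¹ g^φ | g ∈ G⟩` of `χ(G)`. -/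
def L (G : Type*) [Group G] : Subgroup (WeakCommGroup G) :=
  Subgroup.closure (Set.range fun g : G => (ofLeft G g)⁻¹ * ofRight G g)

/-- The subgroup `L₁(G) = [L(G), G]` of `χ(G)`. -/
def L1 (G : Type*) [Group G] : Subgroup (WeakCommGroup G) :=
  ⁅L G, (ofLeft G).range⁆

/-- The subgroup `L₂(G) = [L(G), G^φ]` of `χ(G)`. -/
def L2 (G : Type*) [Group G] : Subgroup (WeakCommGroup G) :=
  ⁅L G, (ofRight G).range⁆

/-- The subgroup `L₁₂(G) = [L₁(G), L₂(G)]` of `χ(G)`. -/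
def L12 (G : Type*) [Group G] : Subgroup (WeakCommGroup G) :=
  ⁅L1 G, L2 G⁆

end WeakCommGroup

section CommutatorFiniteness

open scoped commutatorElement

variable {Γ : Type*} [Group Γ]

/-! Elements killed by both retractions `fst` and `snd` centralize `L G`, and `L12 G` consists of
such elements, so it is central in `L G` and commutators of `L1 G` with `L2 G` are bilinear. By the
three subgroups lemma and the two retractions, this pairing factors through G'/G'' on each side. For
G finitely generated and periodic, G'/G'' is finite, so `L12 G` is abelian, generated by finitely
many elements of finite order. -/

theorem commutatorElement_mul_left_of_commute {a b c : Γ} (h : Commute a ⁅b, c⁆) :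
    ⁅a * b, c⁆ = ⁅b, c⁆ * ⁅a, c⁆ := by
  rw [commutatorElement_mul_left_eq_conj_mul, h.eq, mul_inv_cancel_right]

theorem commutatorElement_mul_right_of_commute {a b c : Γ} (h : Commute b ⁅a, c⁆) :
    ⁅a, b * c⁆ = ⁅a, b⁆ * ⁅a, c⁆ := by
  rw [commutatorElement_mul_right_eq_mul_conj, mul_assoc ⁅a, b⁆, h.eq, ← mul_assoc,
    mul_inv_cancel_right]

theorem commutatorElement_pow_left_of_commute {a c : Γ} (h : Commute a ⁅a, c⁆) (n : ℕ) :
    ⁅a ^ n, c⁆ = ⁅a, c⁆ ^ n := by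
  induction n with
  | zero => simp
  | succ n ih =>
    rw [pow_succ, commutatorElement_mul_left_of_commute (h.pow_left n), ih, ← pow_succ']

/-- A commutator subgroup `⁅H, K⁆` that centralizes `H` and `K` and is induced by a pairing of
finite quotients of `H` and `K` is finite. -/
theorem Subgroup.finite_commutator_of_relIndex_centralizer {H K : Subgroup Γ}
    (hH : ⁅H, K⁆ ≤ centralizer H) (hK : ⁅H, K⁆ ≤ centralizer K)
    (hHK : ⁅H, K⁆ ≤ centralizer (⁅H, K⁆ : Subgroup Γ))
    (iH : (centralizer (K : Set Γ)).relIndex H ≠ 0)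
    (iK : (centralizer (H : Set Γ)).relIndex K ≠ 0) : Finite (⁅H, K⁆ : Subgroup Γ) := by
  have cH : ∀ a ∈ H, ∀ x ∈ H, ∀ y ∈ K, Commute a ⁅x, y⁆ := fun a ha x hx y hy =>
    mem_centralizer_iff.mp (hH (commutator_mem_commutator hx hy)) a ha
  have cK : ∀ a ∈ K, ∀ x ∈ H, ∀ y ∈ K, Commute a ⁅x, y⁆ := fun a ha x hx y hy =>
    mem_centralizer_iff.mp (hK (commutator_mem_commutator hx hy)) a ha
  have left : ∀ x ∈ H, ∀ x' ∈ H, ∀ y ∈ K, x⁻¹ * x' ∈ centralizer (K : Set Γ) →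
      ⁅x, y⁆ = ⁅x', y⁆ := by
    intro x hx x' hx' y hy h
    have h1 : ⁅x⁻¹ * x', y⁆ = 1 :=
      commutatorElement_eq_one_iff_commute.mpr (mem_centralizer_iff.mp h y hy).symm
    have h2 := commutatorElement_mul_left_of_commute
      (cH x hx (x⁻¹ * x') (H.mul_mem (H.inv_mem hx) hx') y hy)
    rw [mul_inv_cancel_left, h1, one_mul] at h2
    exact h2.symm
  have right : ∀ x ∈ H, ∀ y ∈ K, ∀ y' ∈ K, y⁻¹ * y' ∈ centralizer (H : Set Γ) →
      ⁅x, y⁆ = ⁅x, y'⁆ := by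
    intro x hx y hy y' hy' h
    have h1 : ⁅x, y⁻¹ * y'⁆ = 1 :=
      commutatorElement_eq_one_iff_commute.mpr (mem_centralizer_iff.mp h x hx)
    have h2 := commutatorElement_mul_right_of_commute
      (cK y hy x hx (y⁻¹ * y') (K.mul_mem (K.inv_mem hy) hy'))
    rw [mul_inv_cancel_left, h1, mul_one] at h2
    exact h2.symm
  have : Finite (H ⧸ (centralizer (K : Set Γ)).subgroupOf H) := (fintypeOfIndexNeZero iH).finite
  have : Finite (K ⧸ (centralizer (H : Set Γ)).subgroupOf K) := (fintypeOfIndexNeZero iK).finite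
  have hfin : {g | ∃ x ∈ H, ∃ y ∈ K, ⁅x, y⁆ = g}.Finite := by
    refine (Set.finite_range fun p : (H ⧸ (centralizer (K : Set Γ)).subgroupOf H) ×
      (K ⧸ (centralizer (H : Set Γ)).subgroupOf K) =>
        ⁅(p.1.out : Γ), (p.2.out : Γ)⁆).subset ?_
    rintro _ ⟨x, hx, y, hy, rfl⟩
    refine ⟨(QuotientGroup.mk ⟨x, hx⟩, QuotientGroup.mk ⟨y, hy⟩), ?_⟩
    have e1 := QuotientGroup.eq.mp
      (QuotientGroup.out_eq'
        (QuotientGroup.mk (s := (centralizer (K : Set Γ)).subgroupOf H) ⟨x, hx⟩))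
    have e2 := QuotientGroup.eq.mp
      (QuotientGroup.out_eq'
        (QuotientGroup.mk (s := (centralizer (H : Set Γ)).subgroupOf K) ⟨y, hy⟩))
    exact (left _ (SetLike.coe_mem _) x hx _ (SetLike.coe_mem _) e1).trans
      (right x hx _ (SetLike.coe_mem _) y hy e2)
  let : CommGroup (⁅H, K⁆ : Subgroup Γ) :=
    { (inferInstance : Group (⁅H, K⁆ : Subgroup Γ)) with
      mul_comm := fun a b => Subtype.ext (mem_centralizer_iff.mp (hHK b.2) a a.2) }
  have : Group.FG (⁅H, K⁆ : Subgroup Γ) := by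
    have := hfin.to_subtype
    exact Group.closure_finite_fg _
  refine CommGroup.finite_of_fg_isMulTorsion _ ?_
  rintro ⟨z, hz⟩
  rw [← CommGroup.mem_torsion]
  refine closure_induction
    (p := fun z hz => (⟨z, hz⟩ : (⁅H, K⁆ : Subgroup Γ)) ∈
      CommGroup.torsion (⁅H, K⁆ : Subgroup Γ))
    ?_ (one_mem _) (fun _ _ _ _ h1 h2 => mul_mem h1 h2) (fun _ _ h => inv_mem h) hz
  rintro _ ⟨x, hx, y, hy, rfl⟩
  -- A positive power of `x` centralizes `K`, so multiplicativity in `x` bounds the order of `⁅x,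
  -- y⁆`.
  obtain ⟨n, hn, -, hxn⟩ := exists_pow_mem_of_relIndex_ne_zero iH hx
  rw [CommGroup.mem_torsion, isOfFinOrder_iff_pow_eq_one]
  refine ⟨n, hn, Subtype.ext ?_⟩
  change ⁅x, y⁆ ^ n = 1
  rw [← commutatorElement_pow_left_of_commute (cH x hx x hx y hy)]
  exact commutatorElement_eq_one_iff_commute.mpr (mem_centralizer_iff.mp hxn.1 y hy).symm

theorem index_commutator_ne_zero_of_isMulTorsion (G : Type*) [Group G] [Group.FG G]
    (htors : IsMulTorsion G) : (commutator G).index ≠ 0 := by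
  have : Group.FG (Abelianization G) := QuotientGroup.fg _
  have : Finite (Abelianization G) := CommGroup.finite_of_fg_isMulTorsion _
    (htors.of_surjective (f := Abelianization.of) (QuotientGroup.mk'_surjective _))
  have : Finite (G ⧸ commutator G) := this
  exact Subgroup.index_ne_zero_of_finite

/-- G' has finite index, hence is again finitely generated and periodic, and the previous lemma
applies to it. -/
theorem relIndex_commutator_commutator_ne_zero (G : Type*) [Group G] [Group.FG G]
    (htors : IsMulTorsion G) : ⁅commutator G, commutator G⁆.relIndex (commutator G) ≠ 0 := by
  have : (commutator G).FiniteIndex := ⟨index_commutator_ne_zero_of_isMulTorsion G htors⟩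
  have h := index_commutator_ne_zero_of_isMulTorsion (commutator G) (htors.subgroup _)
  rwa [← Subgroup.map_subtype_commutator, Subgroup.relIndex, Subgroup.subgroupOf,
    Subgroup.comap_map_eq_self_of_injective (Subgroup.subtype_injective _)]

/-- An element of `H` over G'' = ρ([H, H]) differs from one of [H, H] by an element of the kernel,
so it centralizes `K`. -/
theorem Subgroup.relIndex_centralizer_ne_zero_of_map_eq_commutator {G : Type*} [Group G]
    [Group.FG G] (htors : IsMulTorsion G) (ρ : Γ →* G) {H K : Subgroup Γ}
    (hmap : H.map ρ = _root_.commutator G) (hker : H ⊓ ρ.ker ≤ centralizer K)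
    (hcomm : ⁅H, H⁆ ≤ centralizer K) : (centralizer (K : Set Γ)).relIndex H ≠ 0 := by
  have h := relIndex_commutator_commutator_ne_zero G htors
  rw [← hmap, ← map_commutator, ← relIndex_comap, ← inf_relIndex_right] at h
  refine mt (fun h0 => relIndex_eq_zero_of_le_left ?_ h0) h
  rintro x ⟨⟨y, hy, hyx⟩, hx⟩
  have hyH : y ∈ H := commutator_le.mpr
    (fun a ha b hb => H.mul_mem (H.mul_mem (H.mul_mem ha hb) (H.inv_mem ha)) (H.inv_mem hb)) hy
  have : y⁻¹ * x ∈ centralizer (K : Set Γ) :=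
    hker ⟨H.mul_mem (H.inv_mem hyH) hx, by simp [hyx]⟩
  simpa using mul_mem (hcomm hy) this

end CommutatorFiniteness

/-! ### Commutator identities under weak commutativity. -/

section WeaklyCommutingHoms

/-- The identity behind the symmetry `[g, h^φ] = [g^φ, h]`. -/
theorem inv_mul_mul_mul_inv_eq_of_commute {X : Type*} [Group X] {p q r s : X} (hpq : Commute p q)
    (hrs : Commute r s) (h : Commute (p * r) (q * s)) :
    q⁻¹ * r * q * r⁻¹ = p⁻¹ * s * p * s⁻¹ :=
  calc q⁻¹ * r * q * r⁻¹ = p⁻¹ * (p * q⁻¹) * r * q * r⁻¹ := by group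
    _ = p⁻¹ * q⁻¹ * ((p * r) * (q * s)) * s⁻¹ * r⁻¹ := by rw [hpq.inv_right.eq]; group
    _ = p⁻¹ * s * p * (r * s⁻¹) * r⁻¹ := by rw [h.eq]; group
    _ = p⁻¹ * s * p * s⁻¹ := by rw [hrs.inv_right.eq]; group

variable {G X : Type*} [Group G] [Group X] {a b : G →* X}

theorem weaklyCommuting_commutator_swap (hab : ∀ g, Commute (a g) (b g)) (g h : G) :
    (a g)⁻¹ * (b h)⁻¹ * a g * b h = (b g)⁻¹ * (a h)⁻¹ * b g * a h := by
  have := inv_mul_mul_mul_inv_eq_of_commute (hab g) (hab h⁻¹)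
    (by simpa only [map_mul] using hab (g * h⁻¹))
  simpa using this.symm

/-- Expand [gk, h^φ] as a conjugate of [g, h^φ] times [k, h^φ]; the swap symmetry turns the
conjugator k into k^φ. -/
theorem weaklyCommuting_conj_commutator (hab : ∀ g, Commute (a g) (b g))
    (g h k : G) :
    (a k)⁻¹ * ((a g)⁻¹ * (b h)⁻¹ * a g * b h) * a k =
      (b k)⁻¹ * ((a g)⁻¹ * (b h)⁻¹ * a g * b h) * b k :=
  calc (a k)⁻¹ * ((a g)⁻¹ * (b h)⁻¹ * a g * b h) * a k
      = ((a (g * k))⁻¹ * (b h)⁻¹ * a (g * k) * b h) * ((a k)⁻¹ * (b h)⁻¹ * a k * b h)⁻¹ := by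
        rw [map_mul]; group
    _ = ((b (g * k))⁻¹ * (a h)⁻¹ * b (g * k) * a h) * ((b k)⁻¹ * (a h)⁻¹ * b k * a h)⁻¹ := by
        rw [weaklyCommuting_commutator_swap hab, weaklyCommuting_commutator_swap hab]
    _ = (b k)⁻¹ * ((b g)⁻¹ * (a h)⁻¹ * b g * a h) * b k := by rw [map_mul]; group
    _ = _ := by rw [weaklyCommuting_commutator_swap hab g h]

/-- Sidki's commutation: `[g, h^φ]` commutes with `k⁻¹ k^φ`. -/
theorem weaklyCommuting_commute_commutator (hab : ∀ g, Commute (a g) (b g))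
    (g h k : G) :
    Commute ((a g)⁻¹ * (b h)⁻¹ * a g * b h) ((a k)⁻¹ * b k) := by
  have e := weaklyCommuting_conj_commutator hab g h k
  set d := (a g)⁻¹ * (b h)⁻¹ * a g * b h
  calc d * ((a k)⁻¹ * b k) = d * (b k * (a k)⁻¹) := by rw [(hab k).inv_left.eq]
    _ = b k * ((b k)⁻¹ * d * b k) * (a k)⁻¹ := by group
    _ = b k * ((a k)⁻¹ * d * a k) * (a k)⁻¹ := by rw [e]
    _ = (b k * (a k)⁻¹) * d := by group
    _ = ((a k)⁻¹ * b k) * d := by rw [(hab k).inv_left.eq]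

end WeaklyCommutingHoms

/-! ### The structure of χ(G). -/

namespace WeakCommGroup

open Subgroup

variable (G : Type*) [Group G]

theorem commute_ofLeft_ofRight (g : G) : Commute (ofLeft G g) (ofRight G g) := by
  have h : (QuotientGroup.mk' (normalClosure (weakCommRelators G)))
      ((Monoid.Coprod.inl g)⁻¹ * (Monoid.Coprod.inr g)⁻¹ * Monoid.Coprod.inl g *
        Monoid.Coprod.inr g) = 1 :=
    (QuotientGroup.eq_one_iff _).mpr (subset_normalClosure ⟨g, rfl⟩)
  simp only [map_mul, map_inv] at h
  change (ofLeft G g)⁻¹ * (ofRight G g)⁻¹ * ofLeft G g * ofRight G g = 1 at h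
  rwa [mul_assoc, ← mul_inv_rev, inv_mul_eq_one, eq_comm] at h

variable {G} in
theorem hom_ext {X : Type*} [Group X] {f g : WeakCommGroup G →* X}
    (hl : f.comp (ofLeft G) = g.comp (ofLeft G)) (hr : f.comp (ofRight G) = g.comp (ofRight G)) :
    f = g :=
  QuotientGroup.monoidHom_ext _ (Monoid.Coprod.hom_ext hl hr)

/-- The retraction `χ(G) → G` killing `G^φ`. -/
def fst : WeakCommGroup G →* G :=
  QuotientGroup.lift _ Monoid.Coprod.fst <| normalClosure_le_normal <| by
    rintro _ ⟨g, rfl⟩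
    simp [MonoidHom.mem_ker]

/-- The retraction `χ(G) → G` killing the left copy of `G`. -/
def snd : WeakCommGroup G →* G :=
  QuotientGroup.lift _ Monoid.Coprod.snd <| normalClosure_le_normal <| by
    rintro _ ⟨g, rfl⟩
    simp [MonoidHom.mem_ker]

theorem fst_comp_ofLeft : (fst G).comp (ofLeft G) = MonoidHom.id G := rfl
theorem fst_comp_ofRight : (fst G).comp (ofRight G) = 1 := rfl
theorem snd_comp_ofLeft : (snd G).comp (ofLeft G) = 1 := rfl
theorem snd_comp_ofRight : (snd G).comp (ofRight G) = MonoidHom.id G := rfl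

theorem range_ofLeft_sup_range_ofRight :
    (ofLeft G).range ⊔ (ofRight G).range = ⊤ := by
  rw [ofLeft, ofRight, MonoidHom.range_comp, MonoidHom.range_comp, ← Subgroup.map_sup,
    Monoid.Coprod.range_inl_sup_range_inr, ← MonoidHom.range_eq_map,
    MonoidHom.range_eq_top.mpr (QuotientGroup.mk'_surjective _)]

/-- With l(g) = g⁻¹g^φ, conjugating l(g) by k or k^φ gives the product of l(gk⁻¹) and l(k⁻¹)⁻¹ in
one order or the other. -/
instance L_normal : (L G).Normal := by
  have hl (g : G) : (ofLeft G g)⁻¹ * ofRight G g ∈ L G := subset_closure ⟨g, rfl⟩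
  rw [← normalizer_eq_top_iff, eq_top_iff, ← range_ofLeft_sup_range_ofRight, sup_le_iff]
  have conj_mem {X : Type _} [Group X] (f : G →* X) (N : Subgroup X) (S : Set X)
      (hN : N = closure S) (h : ∀ k, ∀ s ∈ S, f k * s * (f k)⁻¹ ∈ N) :
      f.range ≤ normalizer (N : Set X) := by
    have hmap (k : G) : N ≤ N.comap (MulAut.conj (f k)).toMonoidHom := by
      conv_lhs => rw [hN]
      exact (closure_le _).mpr fun s hs => h k s hs
    rintro _ ⟨k, rfl⟩
    refine mem_normalizer_iff.mpr fun x => ⟨fun hx => hmap k hx, fun hx => ?_⟩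
    simpa [mul_assoc] using hmap k⁻¹ hx
  constructor <;> refine conj_mem _ _ _ rfl ?_ <;> rintro k _ ⟨g, rfl⟩
  · have e : ofLeft G k * ((ofLeft G g)⁻¹ * ofRight G g) * (ofLeft G k)⁻¹ =
        ((ofLeft G (g * k⁻¹))⁻¹ * ofRight G (g * k⁻¹)) *
          ((ofLeft G k⁻¹)⁻¹ * ofRight G k⁻¹)⁻¹ := by
      simp [mul_assoc]
    rw [e]
    exact mul_mem (hl _) (inv_mem (hl _))
  · have e : ofRight G k * ((ofLeft G g)⁻¹ * ofRight G g) * (ofRight G k)⁻¹ =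
        ((ofLeft G k⁻¹)⁻¹ * ofRight G k⁻¹)⁻¹ *
          ((ofLeft G (g * k⁻¹))⁻¹ * ofRight G (g * k⁻¹)) := by
      simp [mul_assoc]
    rw [e]
    exact mul_mem (inv_mem (hl _)) (hl _)

/-- Modulo the centralizer of `L G`, the two copies of G commute, so the quotient map factors
through `(fst, snd)` into G × G. -/
theorem mem_centralizer_L_of_fst_eq_one_of_snd_eq_one (x : WeakCommGroup G)
    (h1 : fst G x = 1) (h2 : snd G x = 1) :
    x ∈ centralizer (L G : Set (WeakCommGroup G)) := by
  let π := QuotientGroup.mk' (centralizer (L G : Set (WeakCommGroup G)))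
  have hc (g h : G) : Commute (π.comp (ofLeft G) g) (π.comp (ofRight G) h) := by
    have hmem : (ofLeft G g)⁻¹ * (ofRight G h)⁻¹ * ofLeft G g * ofRight G h ∈
        centralizer (L G : Set (WeakCommGroup G)) := by
      rw [L, centralizer_closure, mem_centralizer_iff]
      rintro _ ⟨k, rfl⟩
      exact (weaklyCommuting_commute_commutator (commute_ofLeft_ofRight G) g h k).symm.eq
    have h : π _ = 1 := (QuotientGroup.eq_one_iff _).mpr hmem
    simp only [map_mul, map_inv] at h
    rw [mul_assoc, ← mul_inv_rev, inv_mul_eq_one, eq_comm] at h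
    exact h
  have key : (MonoidHom.noncommCoprod _ _ hc).comp ((fst G).prod (snd G)) = π := by
    refine hom_ext (MonoidHom.ext fun g => ?_) (MonoidHom.ext fun g => ?_)
    · change π (ofLeft G g) * π (ofRight G 1) = π (ofLeft G g)
      simp
    · change π (ofLeft G 1) * π (ofRight G g) = π (ofRight G g)
      simp
  refine (QuotientGroup.eq_one_iff x).mp ?_
  change π x = 1
  rw [← key]
  simp [h1, h2]

theorem map_fst_L : (L G).map (fst G) = ⊤ := by
  refine eq_top_iff.mpr fun g _ => ⟨_, subset_closure ⟨g⁻¹, rfl⟩, ?_⟩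
  rw [map_mul, map_inv, ← MonoidHom.comp_apply, ← MonoidHom.comp_apply, fst_comp_ofLeft,
    fst_comp_ofRight]
  simp

theorem map_snd_L : (L G).map (snd G) = ⊤ := by
  refine eq_top_iff.mpr fun g _ => ⟨_, subset_closure ⟨g, rfl⟩, ?_⟩
  rw [map_mul, map_inv, ← MonoidHom.comp_apply, ← MonoidHom.comp_apply, snd_comp_ofLeft,
    snd_comp_ofRight]
  simp

theorem map_fst_L1 : (L1 G).map (fst G) = commutator G := by
  rw [L1, map_commutator, map_fst_L, MonoidHom.map_range, fst_comp_ofLeft]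
  rw [(MonoidHom.range_eq_top (f := MonoidHom.id G)).mpr Function.surjective_id,
    _root_.commutator_def]

theorem map_snd_L1 : (L1 G).map (snd G) = ⊥ := by
  rw [L1, map_commutator, MonoidHom.map_range, snd_comp_ofLeft]
  simp

theorem map_fst_L2 : (L2 G).map (fst G) = ⊥ := by
  rw [L2, map_commutator, MonoidHom.map_range, fst_comp_ofRight]
  simp

theorem map_snd_L2 : (L2 G).map (snd G) = commutator G := by
  rw [L2, map_commutator, map_snd_L, MonoidHom.map_range, snd_comp_ofRight]
  rw [(MonoidHom.range_eq_top (f := MonoidHom.id G)).mpr Function.surjective_id,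
    _root_.commutator_def]

theorem L1_le_L : L1 G ≤ L G := commutator_le_left _ _
theorem L2_le_L : L2 G ≤ L G := commutator_le_left _ _

theorem L12_le_L : L12 G ≤ L G :=
  (commutator_mono (L1_le_L G) le_top).trans (commutator_le_left _ _)

theorem L12_le_centralizer_L : L12 G ≤ centralizer (L G : Set (WeakCommGroup G)) := by
  intro x hx
  refine mem_centralizer_L_of_fst_eq_one_of_snd_eq_one G x ?_ ?_
  · have : fst G x ∈ (L12 G).map (fst G) := ⟨x, hx, rfl⟩
    rwa [L12, map_commutator, map_fst_L2, commutator_bot_right, mem_bot] at this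
  · have : snd G x ∈ (L12 G).map (snd G) := ⟨x, hx, rfl⟩
    rwa [L12, map_commutator, map_snd_L1, commutator_bot_left, mem_bot] at this

theorem L12_le_centralizer {H : Subgroup (WeakCommGroup G)} (hH : H ≤ L G) :
    L12 G ≤ centralizer (H : Set (WeakCommGroup G)) :=
  (L12_le_centralizer_L G).trans (centralizer_le hH)

theorem finite_L12 [Group.FG G] (htors : IsMulTorsion G) : Finite (L12 G) := by
  have h1 := L12_le_centralizer G (L1_le_L G)
  have h2 := L12_le_centralizer G (L2_le_L G)
  have c1 : ⁅⁅L1 G, L2 G⁆, L1 G⁆ = ⊥ := commutator_eq_bot_iff_le_centralizer.mpr h1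
  have c2 : ⁅⁅L1 G, L2 G⁆, L2 G⁆ = ⊥ := commutator_eq_bot_iff_le_centralizer.mpr h2
  refine finite_commutator_of_relIndex_centralizer h1 h2 (L12_le_centralizer G (L12_le_L G)) ?_ ?_
  · refine relIndex_centralizer_ne_zero_of_map_eq_commutator htors (fst G) (map_fst_L1 G) ?_ ?_
    · rintro x ⟨hx, hx'⟩
      refine centralizer_le (L2_le_L G) (mem_centralizer_L_of_fst_eq_one_of_snd_eq_one G x hx' ?_)
      have : snd G x ∈ (L1 G).map (snd G) := ⟨x, hx, rfl⟩
      rwa [map_snd_L1, mem_bot] at this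
    · rw [← commutator_eq_bot_iff_le_centralizer]
      -- Three subgroups lemma, as `L12 G` centralizes `L1 G`.
      exact commutator_commutator_eq_bot_of_rotate c1 (by rwa [commutator_comm (L2 G)])
  · refine relIndex_centralizer_ne_zero_of_map_eq_commutator htors (snd G) (map_snd_L2 G) ?_ ?_
    · rintro x ⟨hx, hx'⟩
      refine centralizer_le (L1_le_L G) (mem_centralizer_L_of_fst_eq_one_of_snd_eq_one G x ?_ hx')
      have : fst G x ∈ (L2 G).map (fst G) := ⟨x, hx, rfl⟩
      rwa [map_fst_L2, mem_bot] at this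
    · rw [← commutator_eq_bot_iff_le_centralizer]
      exact commutator_commutator_eq_bot_of_rotate (by rwa [commutator_comm (L2 G)]) c2

end WeakCommGroup

theorem corollaryB (G : Type*) [Group G] (hfg : Group.FG G) (htors : IsMulTorsion G) :
    Finite (WeakCommGroup.L12 G) := by
  exact WeakCommGroup.finite_L12 G htors
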